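/- Let $(\Omega,\mathcal F,P)$ be a probability space, $p\in[1,\infty)$, and let $\rho:L^p(P)\to(-\infty,+\infty]$ be a law-invariant coherent risk measure: $\rho(X)\le\rho(Y)$ if $X\ge Y$ a.s.; $\rho(X+c)=\rho(X)-c$ for $c\in\mathbb R$; $\rho$ is convex; $\rho(tX)=t\rho(X)$ for $t>0$; and $\rho(X)=\rho(Y)$ whenever $X,Y$ are equal in distribution. Let $A\in\mathbb R^{n\times n}$ be invertible, $\mu,\gamma\in\mathbb R^n$, $\mu_0=A^{-1}\mu$, $\gamma_0=A^{-1}\gamma$, $e_A=A^{-1}e$ with $e=(1,\dots,1)^T$, and assume that $\mu_0,\gamma_0,e_A$ are linearly independent, i.e. that their Gram matrix $G$ (the $3\times3$ matrix of their inner products) is invertible. Let $Z\ge 0$ be a random variable in $L^p(P)$, $N_n$ an $n$-dimensional standard normal vector and $N$ a standard normal variable, each independent of $Z$, and let $Y$ be a random vector with $Y\overset{d}{=}\mu_0+\gamma_0Z+\sqrt Z\,N_n$. Put $m=\mu_0+\gamma_0\,EZ$ and, for $a,b\in\mathbb R$, $$g(a,b)=(a,b,1)\,G^{-1}(a,b,1)^T,\qquad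 \xi(a,b)=(\mu_0,\gamma_0,e_A)\,G^{-1}(a,b,1)^T\in\mathbb R^n .$$ Let $k\in\mathbb R$, let $D\subseteq\mathbb R^n$ be a set of portfolios, and let $\mathcal R_D=\{x: x^T=\omega^TA,\ \omega\in D\}$. Assume that $D$ does not exclude the candidate points, i.e. $\xi(a,b)\in\mathcal R_D$ whenever $a+b\,EZ\ge k$ (for example $D=\mathbb R^n$ or $D=\{\omega:\omega^Te=1\}$). Consider the $n$-dimensional problem $$\text{(P)}\quad \min_{x\in\mathcal R_D}\ \rho(x^TY)\quad\text{s.t. } x^Te_A=1,\ x^Tm\ge k,$$ and the two-dimensional problem $$\text{(Q)}\quad \min_{(a,b)\in\mathbb R^2}\ \rho\bigl(a+bZ+\sqrt{g(a,b)Z}\,N\bigr)\quad\text{s.t. } a+b\,EZ\ge k .$$ Then: 1. If $(\tilde\mu_0^\star,\tilde\gamma_0^\star)$ is a minimizer of (Q), then $x^\star=\xi(\tilde\mu_0^\star,\tilde\gamma_0^\star)=(\mu_0,\gamma_0,e_A)\,G^{-1}(\tilde\mu_0^\star,\tilde\gamma_0^\star,1)^T$ is a minimizer of (P), and the two minimal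 values coincide. 2. Conversely, if $x$ is a minimizer of (P), then $(x^T\mu_0,x^T\gamma_0)$ is a minimizer of (Q); if moreover the minimal value is finite, then $x=\xi(x^T\mu_0,x^T\gamma_0)$, so that in this case every minimizer of (P) has the form given in 1. 3. The infima of (P) and (Q) (in $[-\infty,+\infty]$) are equal. -/

import Mathlib

open MeasureTheory ProbabilityTheory Matrix

namespace MeanRisk

noncomputable section

/-- `ρ` is a coherent risk measure on `L^p(P)` with values in `(-∞, +∞]`. Random variables are
functions `Ω → ℝ`; only the values of `ρ` on functions in `L^p` are constrained (or ever used), and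
monotonicity forces `ρ` to depend on `X` only through its almost sure class. -/
structure IsCoherent {Ω : Type*} [MeasurableSpace Ω] (P : Measure Ω) (p : ENNReal)
    (ρ : (Ω → ℝ) → EReal) : Prop where
  ne_bot : ∀ X, MemLp X p P → ρ X ≠ ⊥
  monotone : ∀ X Y, MemLp X p P → MemLp Y p P → (∀ᵐ ω ∂P, Y ω ≤ X ω) → ρ X ≤ ρ Y
  cash_invariant : ∀ X, MemLp X p P → ∀ c : ℝ, ρ (fun ω => X ω + c) = ρ X - (c : EReal)
  convex : ∀ X Y, MemLp X p P → MemLp Y p P → ∀ t : ℝ, 0 ≤ t → t ≤ 1 →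
    ρ (fun ω => t * X ω + (1 - t) * Y ω) ≤ (t : EReal) * ρ X + ((1 - t : ℝ) : EReal) * ρ Y
  pos_homogeneous : ∀ X, MemLp X p P → ∀ t : ℝ, 0 < t → ρ (fun ω => t * X ω) = (t : EReal) * ρ X

/-- `ρ` gives the same value to random variables in `L^p(P)` that are equal in distribution. -/
def IsLawInvariant {Ω : Type*} [MeasurableSpace Ω] (P : Measure Ω) (p : ENNReal)
    (ρ : (Ω → ℝ) → EReal) : Prop :=
  ∀ X Y, MemLp X p P → MemLp Y p P → IdentDistrib X Y P P → ρ X = ρ Y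

/-- The set of minimizers of `f` over the feasible set `S`. -/
def argminOn {α : Type*} (f : α → EReal) (S : Set α) : Set α :=
  {x | x ∈ S ∧ ∀ y ∈ S, f x ≤ f y}

/-- The standard normal distribution `N(0, I)` on `ℝⁿ`. -/
def stdNormal (n : ℕ) : Measure (Fin n → ℝ) :=
  Measure.pi fun _ => gaussianReal 0 1

/-- Coefficients of the vector `v` as a linear combination of the columns of the invertible
matrix `A`: the vector `v₀` with `A v₀ = v`. -/
def colCoords {n : ℕ} (A : Matrix (Fin n) (Fin n) ℝ) (v : Fin n → ℝ) : Fin n → ℝ :=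
  A⁻¹ *ᵥ v

/-- The vector `e_A = A⁻¹ e`, where `e = (1, …, 1)ᵀ`. -/
def eA {n : ℕ} (A : Matrix (Fin n) (Fin n) ℝ) : Fin n → ℝ :=
  A⁻¹ *ᵥ (fun _ => 1)

/-- The image `R_D` of a set `D` of portfolios under `w ↦ x`, `xᵀ = wᵀ A`. -/
def portfolioImage {n : ℕ} (A : Matrix (Fin n) (Fin n) ℝ) (D : Set (Fin n → ℝ)) :
    Set (Fin n → ℝ) :=
  (fun w => w ᵥ* A) '' D

/-- The Gram matrix of `u, v, e`. -/
def gramMatrix {n : ℕ} (u v e : Fin n → ℝ) : Matrix (Fin 3) (Fin 3) ℝ :=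
  !![u ⬝ᵥ u, v ⬝ᵥ u, e ⬝ᵥ u;
     u ⬝ᵥ v, v ⬝ᵥ v, e ⬝ᵥ v;
     u ⬝ᵥ e, v ⬝ᵥ e, e ⬝ᵥ e]

/-- The quadratic function `g(a, b) = (a, b, 1) G⁻¹ (a, b, 1)ᵀ`. -/
def gFun {n : ℕ} (u v e : Fin n → ℝ) (a b : ℝ) : ℝ :=
  ![a, b, 1] ⬝ᵥ ((gramMatrix u v e)⁻¹ *ᵥ ![a, b, 1])

/-- The vector `(u, v, e) G⁻¹ (a, b, 1)ᵀ`, where `(u, v, e)` is the `n × 3` matrix with these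
columns. -/
def candidate {n : ℕ} (u v e : Fin n → ℝ) (a b : ℝ) : Fin n → ℝ :=
  (Matrix.of fun i => ![u i, v i, e i]) *ᵥ ((gramMatrix u v e)⁻¹ *ᵥ ![a, b, 1])

/-- Feasible set of the problem in `x`-coordinates: `x ∈ R_D`, `xᵀ e_A = 1`, `xᵀ m ≥ k`, where
`m = u + (E Z) v`. -/
def feasibleX {n : ℕ} (A : Matrix (Fin n) (Fin n) ℝ) (D : Set (Fin n → ℝ)) (u v : Fin n → ℝ)
    (EZ k : ℝ) : Set (Fin n → ℝ) :=
  {x | x ∈ portfolioImage A D ∧ x ⬝ᵥ eA A = 1 ∧ k ≤ x ⬝ᵥ (u + EZ • v)}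

/-- Feasible set of the two-variable problem: `a + b E Z ≥ k`. -/
def feasible2 (EZ k : ℝ) : Set (ℝ × ℝ) :=
  {q | k ≤ q.1 + q.2 * EZ}

/-- Objective `x ↦ ρ(xᵀ Y)`. -/
def riskX {Ω : Type*} {n : ℕ} (ρ : (Ω → ℝ) → EReal) (Y : Ω → Fin n → ℝ) (x : Fin n → ℝ) : EReal :=
  ρ fun ω => x ⬝ᵥ Y ω

/-- Objective `(a, b) ↦ ρ(a + b Z + √(g(a, b) Z) N)`. -/
def risk2 {Ω : Type*} {n : ℕ} (ρ : (Ω → ℝ) → EReal) (Z N : Ω → ℝ) (u v e : Fin n → ℝ)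
    (q : ℝ × ℝ) : EReal :=
  ρ fun ω => q.1 + q.2 * Z ω + Real.sqrt (gFun u v e q.1 q.2 * Z ω) * N ω

end

end MeanRisk

/-!
Write `X(a, b, s) = a + b Z + s √Z N`. Since `Z` is independent of the normal vector, the linear form
`xᵀ Nn` may be replaced by `‖x‖ N`, so `xᵀ Y` has the law of `X(xᵀ μ₀, xᵀ γ₀, ‖x‖)`
(`riskX_eq_risk_mixture`): once the two products `a = xᵀ μ₀` and `b = xᵀ γ₀` are fixed, only the
norm of `x` matters.

The risk of `X(a, b, s)` is nondecreasing in `s ≥ 0` (`risk_mixture_mono`): for `0 ≤ s ≤ s'` the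
variable `X(a, b, s)` is a convex combination of `X(a, b, s')` and `X(a, b, -s')`, which have the
same law by the symmetry of `N`. Hence for given `(a, b)` one should take the shortest `x` with
`xᵀ μ₀ = a`, `xᵀ γ₀ = b`, `xᵀ e_A = 1`. By the normal equations this is `candidate`, its squared
norm is `gFun`, and Pythagoras holds (`dotProduct_self_eq_gFun_add`). So the risk of each feasible
`x` dominates that of the corresponding feasible pair `(a, b)`, with equality at the candidate.
The statements on minimizers and on the infima follow.

Uniqueness does not use strict monotonicity in `s`, which fails for instance for `ρ(X) = -E X`.
If `x` were a minimizer of finite risk strictly longer than its candidate, then by continuity of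
`gFun` the point `(a + ε, b)` would have a candidate still shorter than `x` for some `ε > 0`; it is
feasible, and cash invariance makes its risk at most the risk of `x` minus `ε`.
-/

namespace MeanRisk

/-! ### Laws of normal variance-mean mixtures -/

section Laws

variable {Ω : Type*} [MeasurableSpace Ω] {P : Measure Ω}

/-- A linear form of a standard normal vector is normal with variance the squared norm of its
coefficients. -/
theorem hasLaw_dotProduct_stdNormal {n : ℕ} (x : Fin n → ℝ) :
    HasLaw (fun w : Fin n → ℝ => x ⬝ᵥ w) (gaussianReal 0 (x ⬝ᵥ x).toNNReal) (stdNormal n) := by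
  have hcoord (i : Fin n) : HasLaw (fun w : Fin n → ℝ => w i) (gaussianReal 0 1) (stdNormal n) :=
    (measurePreserving_eval (fun _ : Fin n => gaussianReal 0 1) i).hasLaw
  have hterm (i : Fin n) : HasLaw (fun w : Fin n → ℝ => x i * w i)
      (gaussianReal 0 (x i * x i).toNNReal) (stdNormal n) := by
    have h := gaussianReal_const_mul (hcoord i) (x i)
    convert h using 2
    · simp
    · ext
      simp [Real.coe_toNNReal _ (mul_self_nonneg (x i)), sq]
  have hindep : iIndepFun (fun i (w : Fin n → ℝ) => x i * w i) (stdNormal n) :=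
    iIndepFun_pi (X := fun i t => x i * t) fun i => by fun_prop
  have key (s : Finset (Fin n)) : HasLaw (∑ i ∈ s, fun w : Fin n → ℝ => x i * w i)
      (gaussianReal 0 (∑ i ∈ s, x i * x i).toNNReal) (stdNormal n) := by
    classical
    induction s using Finset.induction_on with
    | empty =>
      have : IsProbabilityMeasure (stdNormal n) := by unfold stdNormal; infer_instance
      simpa using hasLaw_dirac_of_ae_eq (P := stdNormal n) (X := 0) (x := (0 : ℝ))
        Filter.EventuallyEq.rfl
    | insert i s hi ih =>
      have h := gaussianReal_add_gaussianReal_of_indepFun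
        (hindep.indepFun_finsetSum_of_notMem (fun i => by fun_prop) hi) ih.map_eq (hterm i).map_eq
      rw [Finset.sum_insert hi, Finset.sum_insert hi, add_comm]
      refine ⟨ih.aemeasurable.add (hterm i).aemeasurable, ?_⟩
      rw [h, add_zero, add_comm (x i * x i),
        Real.toNNReal_add (Finset.sum_nonneg fun j _ => mul_self_nonneg _) (mul_self_nonneg _)]
  convert key Finset.univ using 1
  · ext w
    simp [dotProduct]
  · rfl

/-- The variable `a + b Z + s √Z N`. -/
noncomputable def mixture (Z N : Ω → ℝ) (a b s : ℝ) : Ω → ℝ :=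
  fun ω => a + b * Z ω + Real.sqrt (Z ω) * (s * N ω)

/-- The law of a mixture depends on the mixed variable only through its law, provided that this
variable is independent of `Z`. -/
theorem identDistrib_mixture_of_indepFun [IsFiniteMeasure P] {Z W W' : Ω → ℝ} {ν : Measure ℝ}
    (hZ : AEMeasurable Z P) (hW : HasLaw W ν P) (hW' : HasLaw W' ν P)
    (hZW : IndepFun Z W P) (hZW' : IndepFun Z W' P) (a b : ℝ) :
    IdentDistrib (fun ω => a + b * Z ω + Real.sqrt (Z ω) * W ω)
      (fun ω => a + b * Z ω + Real.sqrt (Z ω) * W' ω) P P := by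
  have hZ' : HasLaw Z (P.map Z) P := ⟨hZ, rfl⟩
  have := hW.isFiniteMeasure_iff.1 inferInstance
  have h := ((indepFun_iff_hasLaw_prodMk_prod hZ' hW).1 hZW).identDistrib
    ((indepFun_iff_hasLaw_prodMk_prod hZ' hW').1 hZW')
  exact h.comp (u := fun q : ℝ × ℝ => a + b * q.1 + Real.sqrt q.1 * q.2) (by fun_prop)

theorem hasLaw_const_mul_gaussianReal {N : Ω → ℝ} (hN : HasLaw N (gaussianReal 0 1) P) (s : ℝ) :
    HasLaw (fun ω => s * N ω) (gaussianReal 0 (s ^ 2).toNNReal) P := by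
  convert gaussianReal_const_mul hN s using 2
  · simp
  · ext
    simp [sq_nonneg]

theorem identDistrib_mixture_neg [IsFiniteMeasure P] {Z N : Ω → ℝ} (hZ : AEMeasurable Z P)
    (hN : HasLaw N (gaussianReal 0 1) P) (hZN : IndepFun Z N P) (a b s : ℝ) :
    IdentDistrib (mixture Z N a b (-s)) (mixture Z N a b s) P P := by
  refine identDistrib_mixture_of_indepFun hZ (ν := gaussianReal 0 (s ^ 2).toNNReal) ?_
    (hasLaw_const_mul_gaussianReal hN s) ?_ ?_ a b
  · simpa using hasLaw_const_mul_gaussianReal hN (-s)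
  · exact hZN.comp measurable_id (measurable_const_mul (-s))
  · exact hZN.comp measurable_id (measurable_const_mul s)

/-- A linear form of a normal variance-mean mixture is a one-dimensional mixture, whose scale is the
norm of the coefficient vector. -/
theorem identDistrib_dotProduct_mixture [IsFiniteMeasure P] {n : ℕ} {Z N : Ω → ℝ}
    {Nn Y : Ω → Fin n → ℝ} {u v : Fin n → ℝ} (hZ : AEMeasurable Z P)
    (hNn : HasLaw Nn (stdNormal n) P) (hZNn : IndepFun Z Nn P)
    (hN : HasLaw N (gaussianReal 0 1) P) (hZN : IndepFun Z N P)
    (hY : IdentDistrib Y (fun ω => u + Z ω • v + Real.sqrt (Z ω) • Nn ω) P P) (x : Fin n → ℝ) :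
    IdentDistrib (fun ω => x ⬝ᵥ Y ω)
      (mixture Z N (x ⬝ᵥ u) (x ⬝ᵥ v) (Real.sqrt (x ⬝ᵥ x))) P P := by
  have hmeas : Measurable fun w : Fin n → ℝ => x ⬝ᵥ w := by
    unfold dotProduct
    fun_prop
  have hlin := hY.comp hmeas
  have hform : HasLaw (fun ω => x ⬝ᵥ Nn ω) (gaussianReal 0 (x ⬝ᵥ x).toNNReal) P :=
    (hasLaw_dotProduct_stdNormal x).comp hNn
  have hscale : HasLaw (fun ω => Real.sqrt (x ⬝ᵥ x) * N ω)
      (gaussianReal 0 (x ⬝ᵥ x).toNNReal) P := by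
    have h := hasLaw_const_mul_gaussianReal hN (Real.sqrt (x ⬝ᵥ x))
    have hnonneg : 0 ≤ x ⬝ᵥ x := Finset.sum_nonneg fun i _ => mul_self_nonneg (x i)
    rwa [Real.sq_sqrt hnonneg] at h
  have h := identDistrib_mixture_of_indepFun hZ hform hscale (hZNn.comp measurable_id hmeas)
    (hZN.comp measurable_id (measurable_const_mul (Real.sqrt (x ⬝ᵥ x)))) (x ⬝ᵥ u) (x ⬝ᵥ v)
  refine hlin.trans ?_
  unfold mixture
  convert h using 2 with ω
  simp only [Function.comp, dotProduct_add, dotProduct_smul, smul_eq_mul]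
  ring

/-- The product of two independent variables in `L^p` is in `L^p`. -/
theorem memLp_mul_of_indepFun {X W : Ω → ℝ} {p : ENNReal} (hp0 : p ≠ 0) (hp_top : p ≠ ⊤)
    (hX : MemLp X p P) (hW : MemLp W p P) (hXW : IndepFun X W P) :
    MemLp (fun ω => X ω * W ω) p P := by
  have hmeas : Measurable fun t : ℝ => ‖t‖ ^ p.toReal := by fun_prop
  have h := (hXW.comp hmeas hmeas).integrable_mul
    ((integrable_norm_rpow_iff hX.aestronglyMeasurable hp0 hp_top).2 hX)
    ((integrable_norm_rpow_iff hW.aestronglyMeasurable hp0 hp_top).2 hW)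
  refine (integrable_norm_rpow_iff
    (hX.aestronglyMeasurable.mul hW.aestronglyMeasurable) hp0 hp_top).1 ?_
  convert h using 2 with ω
  simp [Real.mul_rpow]

theorem memLp_sqrt [IsFiniteMeasure P] {Z : Ω → ℝ} {p : ENNReal} (hZ : MemLp Z p P) :
    MemLp (fun ω => Real.sqrt (Z ω)) p P := by
  refine ((memLp_const (1 : ℝ)).add hZ.norm).of_le
    hZ.aestronglyMeasurable.aemeasurable.sqrt.aestronglyMeasurable (ae_of_all _ fun ω => ?_)
  have h0 : 0 ≤ |Z ω| := abs_nonneg _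
  have h : Real.sqrt (Z ω) ≤ 1 + |Z ω| :=
    (Real.sqrt_le_sqrt (le_abs_self _)).trans
      (Real.sqrt_le_iff.2 ⟨by positivity, by nlinarith⟩)
  simpa [abs_of_nonneg (Real.sqrt_nonneg _), abs_of_nonneg (add_nonneg zero_le_one h0)] using h

theorem memLp_mixture [IsFiniteMeasure P] {Z N : Ω → ℝ} {p : ENNReal} (hp0 : p ≠ 0)
    (hp_top : p ≠ ⊤) (hZ : MemLp Z p P) (hN : HasLaw N (gaussianReal 0 1) P)
    (hZN : IndepFun Z N P) (a b s : ℝ) : MemLp (mixture Z N a b s) p P := by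
  have hNp : MemLp N p P :=
    (HasLaw.id.identDistrib hN).memLp_snd (memLp_id_gaussianReal' p hp_top)
  exact ((memLp_const a).add (hZ.const_mul b)).add
    (memLp_mul_of_indepFun hp0 hp_top (memLp_sqrt hZ) (hNp.const_mul s)
      (hZN.comp Real.continuous_sqrt.measurable (measurable_const_mul s)))

end Laws

/-! ### The risk of a mixture -/

section Risk

variable {Ω : Type*} [MeasurableSpace Ω] {P : Measure Ω} {p : ENNReal} {ρ : (Ω → ℝ) → EReal}

/-- The risk of a convex combination of two variables of equal risk is at most this risk. -/
theorem IsCoherent.convex_comb_le_of_eq (hρ : IsCoherent P p ρ) {X X' : Ω → ℝ}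
    (hX : MemLp X p P) (hX' : MemLp X' p P) (h : ρ X' = ρ X) {t : ℝ} (h0 : 0 ≤ t) (h1 : t ≤ 1) :
    ρ (fun ω => t * X ω + (1 - t) * X' ω) ≤ ρ X := by
  have hc := hρ.convex X X' hX hX' t h0 h1
  rw [h] at hc
  rcases eq_or_ne (ρ X) ⊤ with htop | htop
  · rw [htop]
    exact le_top
  · lift ρ X to ℝ using ⟨htop, hρ.ne_bot X hX⟩ with r
    refine hc.trans (le_of_eq ?_)
    norm_cast
    ring

/-- The risk of a mixture is nondecreasing in the scale: the smaller scale gives a convex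
combination of the larger scale and its negative, which have the same law. -/
theorem risk_mixture_mono [IsFiniteMeasure P] (hp0 : p ≠ 0) (hp_top : p ≠ ⊤)
    (hρ : IsCoherent P p ρ) (hlaw : IsLawInvariant P p ρ) {Z N : Ω → ℝ} (hZ : MemLp Z p P)
    (hN : HasLaw N (gaussianReal 0 1) P) (hZN : IndepFun Z N P) (a b : ℝ) {s s' : ℝ}
    (hs : 0 ≤ s) (hss' : s ≤ s') :
    ρ (mixture Z N a b s) ≤ ρ (mixture Z N a b s') := by
  rcases hss'.eq_or_lt with rfl | hlt
  · exact le_rfl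
  have hs' : 0 < s' := hs.trans_lt hlt
  have hm := memLp_mixture hp0 hp_top hZ hN hZN a b
  have hsym : ρ (mixture Z N a b (-s')) = ρ (mixture Z N a b s') :=
    hlaw _ _ (hm _) (hm _)
      (identDistrib_mixture_neg hZ.aestronglyMeasurable.aemeasurable hN hZN a b s')
  have hr : s / s' ≤ 1 := (div_le_one hs').2 hss'
  have hr0 : 0 ≤ s / s' := div_nonneg hs hs'.le
  -- The weight `t` solves `t s' + (1 - t) (-s') = s`.
  have h := hρ.convex_comb_le_of_eq (hm s') (hm (-s')) hsym (t := (1 + s / s') / 2)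
    (by linarith) (by linarith)
  convert h using 2
  ext ω
  simp only [mixture]
  field_simp
  ring

theorem risk_mixture_add (hρ : IsCoherent P p ρ) {Z N : Ω → ℝ} {a b s : ℝ}
    (hm : MemLp (mixture Z N a b s) p P) (c : ℝ) :
    ρ (mixture Z N (a + c) b s) = ρ (mixture Z N a b s) - (c : EReal) := by
  rw [← hρ.cash_invariant _ hm c]
  congr 1
  ext ω
  simp only [mixture]
  ring

theorem riskX_eq_risk_mixture [IsFiniteMeasure P] (hp0 : p ≠ 0) (hp_top : p ≠ ⊤)
    (hlaw : IsLawInvariant P p ρ) {n : ℕ} {Z N : Ω → ℝ} {Nn Y : Ω → Fin n → ℝ}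
    {u v : Fin n → ℝ} (hZ : MemLp Z p P) (hNn : HasLaw Nn (stdNormal n) P)
    (hZNn : IndepFun Z Nn P) (hN : HasLaw N (gaussianReal 0 1) P) (hZN : IndepFun Z N P)
    (hY : IdentDistrib Y (fun ω => u + Z ω • v + Real.sqrt (Z ω) • Nn ω) P P) (x : Fin n → ℝ) :
    riskX ρ Y x = ρ (mixture Z N (x ⬝ᵥ u) (x ⬝ᵥ v) (Real.sqrt (x ⬝ᵥ x))) := by
  have h := identDistrib_dotProduct_mixture hZ.aestronglyMeasurable.aemeasurable hNn hZNn hN hZN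
    hY x
  have hm := memLp_mixture hp0 hp_top hZ hN hZN (x ⬝ᵥ u) (x ⬝ᵥ v) (Real.sqrt (x ⬝ᵥ x))
  exact hlaw _ _ (h.symm.memLp_snd hm) hm h

end Risk

theorem risk2_eq_risk_mixture {Ω : Type*} {ρ : (Ω → ℝ) → EReal} {n : ℕ} {Z N : Ω → ℝ}
    {u v e : Fin n → ℝ} {a b : ℝ} (hg : 0 ≤ gFun u v e a b) :
    risk2 ρ Z N u v e (a, b) = ρ (mixture Z N a b (Real.sqrt (gFun u v e a b))) := by
  unfold risk2 mixture
  congr 1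
  ext ω
  rw [Real.sqrt_mul hg]
  ring

/-! ### Shortest vectors with prescribed inner products -/

section Gram

variable {n : ℕ} {u v e : Fin n → ℝ}

theorem vecMul_columns (x : Fin n → ℝ) :
    x ᵥ* (Matrix.of fun i => ![u i, v i, e i]) = ![x ⬝ᵥ u, x ⬝ᵥ v, x ⬝ᵥ e] := by
  ext j
  fin_cases j <;> simp [vecMul, dotProduct]

theorem transpose_mul_columns :
    (Matrix.of fun i => ![u i, v i, e i])ᵀ * (Matrix.of fun i => ![u i, v i, e i]) =
      gramMatrix u v e := by
  ext j l
  fin_cases j <;> fin_cases l <;>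
    simp [gramMatrix, Matrix.mul_apply, dotProduct, mul_comm]

/-- The candidate has the prescribed inner products: its coefficients solve the normal equations. -/
theorem candidate_dotProducts (hG : IsUnit (gramMatrix u v e).det) (a b : ℝ) :
    ![candidate u v e a b ⬝ᵥ u, candidate u v e a b ⬝ᵥ v, candidate u v e a b ⬝ᵥ e] =
      ![a, b, 1] := by
  rw [← vecMul_columns, ← mulVec_transpose, candidate, mulVec_mulVec, transpose_mul_columns,
    mulVec_mulVec, Matrix.mul_nonsing_inv _ hG, one_mulVec]

theorem candidate_dotProduct_left (hG : IsUnit (gramMatrix u v e).det) (a b : ℝ) :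
    candidate u v e a b ⬝ᵥ u = a := congrFun (candidate_dotProducts hG a b) 0

theorem candidate_dotProduct_middle (hG : IsUnit (gramMatrix u v e).det) (a b : ℝ) :
    candidate u v e a b ⬝ᵥ v = b := congrFun (candidate_dotProducts hG a b) 1

theorem candidate_dotProduct_right (hG : IsUnit (gramMatrix u v e).det) (a b : ℝ) :
    candidate u v e a b ⬝ᵥ e = 1 := congrFun (candidate_dotProducts hG a b) 2

/-- The inner product with the candidate is constant on the affine space of admissible vectors. -/
theorem dotProduct_candidate {x : Fin n → ℝ} (hx : x ⬝ᵥ e = 1) :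
    x ⬝ᵥ candidate u v e (x ⬝ᵥ u) (x ⬝ᵥ v) = gFun u v e (x ⬝ᵥ u) (x ⬝ᵥ v) := by
  rw [candidate, dotProduct_mulVec, vecMul_columns, hx, gFun]

theorem candidate_dotProduct_self (hG : IsUnit (gramMatrix u v e).det) (a b : ℝ) :
    candidate u v e a b ⬝ᵥ candidate u v e a b = gFun u v e a b := by
  have h := dotProduct_candidate (u := u) (v := v) (candidate_dotProduct_right hG a b)
  rwa [candidate_dotProduct_left hG, candidate_dotProduct_middle hG] at h

theorem gFun_nonneg (hG : IsUnit (gramMatrix u v e).det) (a b : ℝ) : 0 ≤ gFun u v e a b := by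
  rw [← candidate_dotProduct_self hG]
  exact Finset.sum_nonneg fun i _ => mul_self_nonneg _

/-- Pythagoras: an admissible vector splits orthogonally into the candidate and the rest. -/
theorem dotProduct_self_eq_gFun_add (hG : IsUnit (gramMatrix u v e).det) {x : Fin n → ℝ}
    (hx : x ⬝ᵥ e = 1) :
    x ⬝ᵥ x = gFun u v e (x ⬝ᵥ u) (x ⬝ᵥ v) +
      (x - candidate u v e (x ⬝ᵥ u) (x ⬝ᵥ v)) ⬝ᵥ (x - candidate u v e (x ⬝ᵥ u) (x ⬝ᵥ v)) := by
  have h := dotProduct_candidate (u := u) (v := v) hx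
  rw [sub_dotProduct, dotProduct_sub, dotProduct_sub, candidate_dotProduct_self hG,
    dotProduct_comm (candidate u v e _ _) x, h]
  ring

theorem gFun_le_dotProduct_self (hG : IsUnit (gramMatrix u v e).det) {x : Fin n → ℝ}
    (hx : x ⬝ᵥ e = 1) : gFun u v e (x ⬝ᵥ u) (x ⬝ᵥ v) ≤ x ⬝ᵥ x := by
  rw [dotProduct_self_eq_gFun_add hG hx]
  exact le_add_of_nonneg_right (Finset.sum_nonneg fun i _ => mul_self_nonneg _)

theorem gFun_lt_dotProduct_self (hG : IsUnit (gramMatrix u v e).det) {x : Fin n → ℝ}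
    (hx : x ⬝ᵥ e = 1) (hne : x ≠ candidate u v e (x ⬝ᵥ u) (x ⬝ᵥ v)) :
    gFun u v e (x ⬝ᵥ u) (x ⬝ᵥ v) < x ⬝ᵥ x := by
  refine lt_of_le_of_ne (gFun_le_dotProduct_self hG hx) fun h => hne ?_
  have hP := dotProduct_self_eq_gFun_add hG hx
  rw [← h] at hP
  exact sub_eq_zero.1 (dotProduct_self_eq_zero.1 (by linarith))

theorem continuous_gFun_left (b : ℝ) : Continuous fun a => gFun u v e a b := by
  simp only [gFun, dotProduct, mulVec, Fin.sum_univ_three]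
  simp only [Matrix.cons_val_zero, Matrix.cons_val_one, Matrix.cons_val]
  fun_prop

open Topology in
theorem exists_pos_gFun_add_lt {a b c : ℝ} (h : gFun u v e a b < c) :
    ∃ t : ℝ, 0 < t ∧ gFun u v e (a + t) b < c := by
  have hc : Continuous fun t : ℝ => gFun u v e (a + t) b :=
    (continuous_gFun_left b).comp (continuous_const.add continuous_id)
  have hev : ∀ᶠ t in 𝓝[>] (0 : ℝ), gFun u v e (a + t) b < c :=
    ((hc.tendsto 0).eventually_lt_const (by simpa using h)).filter_mono nhdsWithin_le_nhds
  obtain ⟨t, htlt, ht⟩ := (hev.and self_mem_nhdsWithin).exists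
  exact ⟨t, ht, htlt⟩

end Gram

end MeanRisk

/-! ### Reduction to the two-variable problem -/

theorem mainTheorem2 {Ω : Type*} [MeasurableSpace Ω] (P : Measure Ω) [IsProbabilityMeasure P]
    (p : ENNReal) (hp : 1 ≤ p) (hp_top : p ≠ ⊤)
    (ρ : (Ω → ℝ) → EReal) (hρ : MeanRisk.IsCoherent P p ρ) (hlaw : MeanRisk.IsLawInvariant P p ρ)
    (n : ℕ) (A : Matrix (Fin n) (Fin n) ℝ) (hA : IsUnit A.det)
    (μ γ μ₀ γ₀ : Fin n → ℝ)
    (hμ₀ : μ₀ = MeanRisk.colCoords A μ) (hγ₀ : γ₀ = MeanRisk.colCoords A γ)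
    -- mixing variable `Z ≥ 0` in `L^p`, independent of the normal variables `Nn` and `N`
    (Z N : Ω → ℝ) (Nn : Ω → Fin n → ℝ)
    (hZ : MemLp Z p P) (hZ_nonneg : ∀ᵐ ω ∂P, 0 ≤ Z ω)
    (hNn : HasLaw Nn (MeanRisk.stdNormal n) P) (hZNn : IndepFun Z Nn P)
    (hN : HasLaw N (gaussianReal 0 1) P) (hZN : IndepFun Z N P)
    (Y : Ω → Fin n → ℝ)
    (hY : IdentDistrib Y (fun ω => μ₀ + Z ω • γ₀ + Real.sqrt (Z ω) • Nn ω) P P)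
    (hG : IsUnit (MeanRisk.gramMatrix μ₀ γ₀ (MeanRisk.eA A)).det)
    (k : ℝ)
    -- the portfolio set `D` does not exclude any of the candidate optima
    (D : Set (Fin n → ℝ))
    (hD : ∀ a b : ℝ, (a, b) ∈ MeanRisk.feasible2 (∫ ω, Z ω ∂P) k →
      MeanRisk.candidate μ₀ γ₀ (MeanRisk.eA A) a b ∈ MeanRisk.portfolioImage A D) :
    -- every minimizer of the two-variable problem yields a minimizer, with the same risk
    (∀ a b : ℝ,
      (a, b) ∈ MeanRisk.argminOn (MeanRisk.risk2 ρ Z N μ₀ γ₀ (MeanRisk.eA A))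
        (MeanRisk.feasible2 (∫ ω, Z ω ∂P) k) →
      MeanRisk.candidate μ₀ γ₀ (MeanRisk.eA A) a b ∈
          MeanRisk.argminOn (MeanRisk.riskX ρ Y)
            (MeanRisk.feasibleX A D μ₀ γ₀ (∫ ω, Z ω ∂P) k) ∧
        MeanRisk.riskX ρ Y (MeanRisk.candidate μ₀ γ₀ (MeanRisk.eA A) a b) =
          MeanRisk.risk2 ρ Z N μ₀ γ₀ (MeanRisk.eA A) (a, b)) ∧
    -- every minimizer comes from a minimizer of the two-variable problem
    (∀ x ∈ MeanRisk.argminOn (MeanRisk.riskX ρ Y)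
        (MeanRisk.feasibleX A D μ₀ γ₀ (∫ ω, Z ω ∂P) k),
      (x ⬝ᵥ μ₀, x ⬝ᵥ γ₀) ∈ MeanRisk.argminOn (MeanRisk.risk2 ρ Z N μ₀ γ₀ (MeanRisk.eA A))
          (MeanRisk.feasible2 (∫ ω, Z ω ∂P) k) ∧
        (MeanRisk.riskX ρ Y x ≠ ⊤ →
          x = MeanRisk.candidate μ₀ γ₀ (MeanRisk.eA A) (x ⬝ᵥ μ₀) (x ⬝ᵥ γ₀))) ∧
    -- the optimal values agree
    (⨅ x ∈ MeanRisk.feasibleX A D μ₀ γ₀ (∫ ω, Z ω ∂P) k, MeanRisk.riskX ρ Y x) =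
      ⨅ q ∈ MeanRisk.feasible2 (∫ ω, Z ω ∂P) k,
        MeanRisk.risk2 ρ Z N μ₀ γ₀ (MeanRisk.eA A) q := by
  have hp0 : p ≠ 0 := (zero_lt_one.trans_le hp).ne'
  set EZ := ∫ ω, Z ω ∂P
  set e := MeanRisk.eA A
  have hmix := MeanRisk.memLp_mixture hp0 hp_top hZ hN hZN
  have hX := MeanRisk.riskX_eq_risk_mixture hp0 hp_top hlaw hZ hNn hZNn hN hZN hY
  have h2 (a b : ℝ) := MeanRisk.risk2_eq_risk_mixture (ρ := ρ) (Z := Z) (N := N)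
    (MeanRisk.gFun_nonneg hG a b)
  have hcand (a b : ℝ) : MeanRisk.riskX ρ Y (MeanRisk.candidate μ₀ γ₀ e a b) =
      MeanRisk.risk2 ρ Z N μ₀ γ₀ e (a, b) := by
    rw [hX, h2, MeanRisk.candidate_dotProduct_left hG, MeanRisk.candidate_dotProduct_middle hG,
      MeanRisk.candidate_dotProduct_self hG]
  have hcand_mem (a b : ℝ) (hab : (a, b) ∈ MeanRisk.feasible2 EZ k) :
      MeanRisk.candidate μ₀ γ₀ e a b ∈ MeanRisk.feasibleX A D μ₀ γ₀ EZ k := by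
    refine ⟨hD a b hab, MeanRisk.candidate_dotProduct_right hG a b, ?_⟩
    rw [dotProduct_add, dotProduct_smul, MeanRisk.candidate_dotProduct_left hG,
      MeanRisk.candidate_dotProduct_middle hG, smul_eq_mul, mul_comm]
    exact hab
  have hproj (x : Fin n → ℝ) (hx : x ∈ MeanRisk.feasibleX A D μ₀ γ₀ EZ k) :
      (x ⬝ᵥ μ₀, x ⬝ᵥ γ₀) ∈ MeanRisk.feasible2 EZ k := by
    have h := hx.2.2
    rwa [dotProduct_add, dotProduct_smul, smul_eq_mul, mul_comm] at h
  have hle (x : Fin n → ℝ) (hx : x ∈ MeanRisk.feasibleX A D μ₀ γ₀ EZ k) :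
      MeanRisk.risk2 ρ Z N μ₀ γ₀ e (x ⬝ᵥ μ₀, x ⬝ᵥ γ₀) ≤ MeanRisk.riskX ρ Y x := by
    rw [h2, hX]
    exact MeanRisk.risk_mixture_mono hp0 hp_top hρ hlaw hZ hN hZN _ _ (Real.sqrt_nonneg _)
      (Real.sqrt_le_sqrt (MeanRisk.gFun_le_dotProduct_self hG hx.2.1))
  refine ⟨fun a b hab => ⟨⟨hcand_mem a b hab.1, fun y hy => ?_⟩, hcand a b⟩,
    fun x hx => ⟨⟨hproj x hx.1, fun q hq => ?_⟩, fun hfin => ?_⟩, le_antisymm ?_ ?_⟩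
  · rw [hcand]
    exact (hab.2 _ (hproj y hy)).trans (hle y hy)
  · refine (hle x hx.1).trans ((hx.2 _ (hcand_mem q.1 q.2 hq)).trans ?_)
    rw [hcand]
  · by_contra hne
    -- Raising `a` by `t` keeps feasibility and, since `x` is strictly longer than needed, leaves a
    -- candidate shorter than `x`; cash invariance then gains `t`.
    obtain ⟨t, ht0, htlt⟩ :=
      MeanRisk.exists_pos_gFun_add_lt (MeanRisk.gFun_lt_dotProduct_self hG hx.1.2.1 hne)
    have hfeas : (x ⬝ᵥ μ₀ + t, x ⬝ᵥ γ₀) ∈ MeanRisk.feasible2 EZ k := by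
      have h : k ≤ x ⬝ᵥ μ₀ + x ⬝ᵥ γ₀ * EZ := hproj x hx.1
      change k ≤ x ⬝ᵥ μ₀ + t + x ⬝ᵥ γ₀ * EZ
      linarith
    have hbound : MeanRisk.riskX ρ Y x ≤ MeanRisk.riskX ρ Y x - (t : EReal) := by
      calc MeanRisk.riskX ρ Y x
          ≤ MeanRisk.risk2 ρ Z N μ₀ γ₀ e (x ⬝ᵥ μ₀ + t, x ⬝ᵥ γ₀) := by
            rw [← hcand]
            exact hx.2 _ (hcand_mem _ _ hfeas)
        _ ≤ ρ (MeanRisk.mixture Z N (x ⬝ᵥ μ₀ + t) (x ⬝ᵥ γ₀) (Real.sqrt (x ⬝ᵥ x))) := by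
            rw [h2]
            exact MeanRisk.risk_mixture_mono hp0 hp_top hρ hlaw hZ hN hZN _ _
              (Real.sqrt_nonneg _) (Real.sqrt_le_sqrt htlt.le)
        _ = MeanRisk.riskX ρ Y x - (t : EReal) := by
            rw [MeanRisk.risk_mixture_add hρ (hmix _ _ _), hX]
    have hbot : MeanRisk.riskX ρ Y x ≠ ⊥ := by
      rw [hX]
      exact hρ.ne_bot _ (hmix _ _ _)
    lift MeanRisk.riskX ρ Y x to ℝ using ⟨hfin, hbot⟩ with r
    norm_cast at hbound
    linarith
  · refine le_iInf₂ fun q hq => (iInf₂_le _ (hcand_mem q.1 q.2 hq)).trans ?_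
    rw [hcand]
  · exact le_iInf₂ fun x hx => (iInf₂_le _ (hproj x hx)).trans (hle x hx)
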